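/- Fix a notion of small set. $\mathsf{Cat}$ is the 2-category of small categories and $\mathsf{CAT}$ the 2-category of locally small (possibly large) categories. For a small category $A$ let $\widehat A=[A^{op},\mathsf{Set}]$, with Yoneda embedding $y_A:A\to\widehat A$. A *category with arities* $(A,E,I)$ is a locally small category $E$ with a small category $A$ and a full, faithful and dense functor $I:A\to E$; its nerve functor is $N_I:E\to\widehat A$, $N_I(e)=E(I-,e)$. For a functor $K:E\to F$ between the ambient categories of $(A,E,I)$ and $(B,F,J)$ put $\overline K=\mathrm{Lan}_{y_A}(N_J\circ K\circ I):\widehat A\to\widehat B$. The functor $K$ *respects arities* if $\overline K\circ N_I\cong N_J\circ K$. $\mathsf{CwA}$ is the 2-category whose objects are the categories with arities, whose 1-cells $(A,E,I)\to(B,F,J)$ are the arities-respecting functors $E\to F$, and whose 2-cells are all natural transformations. $\mathsf{CAT}^{\mathbf 2}$ is the 2-category whose objects are the functors in $\mathsf{CAT}$, whose 1-cells are the squares of functors commuting up to a specified natural isomorphism, and whose 2-cells are the compatible pairs of natural transformations. The nerve 2-functor (pseudofunctor) $N:\mathsf{CwA}\to\mathsf{CAT}^{\mathbf 2}$ sends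 $(A,E,I)$ to $N_I:E\to\widehat A$, a 1-cell $K$ to the square $(K,\overline K)$ with a chosen isomorphism $\overline K N_I\cong N_JK$, and a 2-cell to the unique compatible pair extending it. Let $\mathsf{CwA}_{sq}$ be the strict model of $\mathsf{CwA}$ with the same objects, whose 1-cells are the 1-cells $(K,G,\varphi:GN_I\cong N_JK)$ of $\mathsf{CAT}^{\mathbf 2}$ between nerve functors with $G$ cocontinuous, and whose 2-cells are those of $\mathsf{CAT}^{\mathbf 2}$; sending $K$ to $(K,\overline K)$ gives $\mathsf{CwA}\simeq\mathsf{CwA}_{sq}$, and $\mathsf{CwA}_{sq}\to\mathsf{CAT}^{\mathbf 2}$ is a strict 2-functor. **Proposition.** The 2-functor $\mathsf{CwA}\to\mathsf{CAT}^{\mathbf 2}$ reflects all weighted limits: 1. (Limits up to equivalence.) Let $\mathcal J$ be a bicategory, let $W:\mathcal J\to\mathsf{Cat}$ and $D:\mathcal J\to\mathsf{CwA}$ be pseudofunctors, and let $c:W\Rightarrow\mathsf{CwA}(X,D-)$ be a pseudonatural transformation (a weighted cone). If its image $Nc$ is a $W$-weighted limit of $ND$ in $\mathsf{CAT}^{\mathbf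 2}$, that is, for every object $Y$ composition with $Nc$ is an equivalence from $\mathsf{CAT}^{\mathbf 2}(Y,NX)$ to the category of pseudonatural transformations $W\Rightarrow\mathsf{CAT}^{\mathbf 2}(Y,ND-)$ and modifications, then $c$ is a $W$-weighted limit of $D$ in $\mathsf{CwA}$ in the same sense. 2. (Strict limits.) Let $\mathcal J$ be a 2-category, let $W:\mathcal J\to\mathsf{Cat}$ and $D:\mathcal J\to\mathsf{CwA}_{sq}$ be strict 2-functors, and let $c:W\Rightarrow\mathsf{CwA}_{sq}(X,D-)$ be a 2-natural transformation. If the image of $c$ is a $\mathsf{Cat}$-enriched $W$-weighted limit in $\mathsf{CAT}^{\mathbf 2}$, that is, the comparison functors to the categories of 2-natural transformations and modifications are isomorphisms of categories, then $c$ is a $\mathsf{Cat}$-enriched $W$-weighted limit in $\mathsf{CwA}_{sq}$. -/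

import Mathlib

open CategoryTheory Bicategory

set_option linter.unusedVariables false

universe w w₁ w₂ w₃ v₁ v₂ v₃ v₄ u₁ u₂ u₃ u₄

/-! ## Weighted cones and weighted limits in a bicategory -/

section WeightedLimits

variable {J : Type u₁} [Bicategory.{w₁, v₁} J]
  {B : Type u₂} [Bicategory.{w₂, v₂} B] {C : Type u₃} [Bicategory.{w₃, v₃} C]

/-- A `W`-weighted cone over `D` with vertex `X`: a pseudonatural transformation from the weight
`W` to `j ↦ Hom (X, D j)`, written out in components. -/
structure CatWeightedCone (W : Pseudofunctor J Cat.{v₄, u₄}) (D : Pseudofunctor J B) (X : B) where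
  /-- the component at `j`, a functor `W j ⥤ Hom (X, D j)` -/
  app (j : J) : W.obj j ⥤ (X ⟶ D.obj j)
  /-- the invertible naturality constraint at a `1`-cell `f` of `J` -/
  nat {i j : J} (f : i ⟶ j) (x : W.obj i) :
    (app j).obj ((W.map f).toFunctor.obj x) ≅ (app i).obj x ≫ D.map f
  nat_naturality {i j : J} (f : i ⟶ j) {x y : W.obj i} (u : x ⟶ y) :
    (app j).map ((W.map f).toFunctor.map u) ≫ (nat f y).hom =
      (nat f x).hom ≫ (app i).map u ▷ D.map f
  nat_map₂ {i j : J} {f g : i ⟶ j} (η : f ⟶ g) (x : W.obj i) :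
    (app j).map ((W.map₂ η).toNatTrans.app x) ≫ (nat g x).hom =
      (nat f x).hom ≫ (app i).obj x ◁ D.map₂ η
  nat_id (i : J) (x : W.obj i) :
    (nat (𝟙 i) x).hom ≫ (app i).obj x ◁ (D.mapId i).hom ≫ (ρ_ ((app i).obj x)).hom =
      (app i).map ((W.mapId i).hom.toNatTrans.app x)
  nat_comp {i j k : J} (f : i ⟶ j) (g : j ⟶ k) (x : W.obj i) :
    (nat (f ≫ g) x).hom ≫ (app i).obj x ◁ (D.mapComp f g).hom =
      (app k).map ((W.mapComp f g).hom.toNatTrans.app x) ≫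
        (nat g ((W.map f).toFunctor.obj x)).hom ≫ (nat f x).hom ▷ D.map g ≫
          (α_ ((app i).obj x) (D.map f) (D.map g)).hom

namespace CatWeightedCone

variable {W : Pseudofunctor J Cat.{v₄, u₄}} {D : Pseudofunctor J B} {X Y : B}

/-- A morphism of weighted cones with the same vertex: a modification. -/
@[ext]
structure Hom (c d : CatWeightedCone W D X) where
  /-- the component at `j` -/
  app (j : J) : c.app j ⟶ d.app j
  comm {i j : J} (f : i ⟶ j) (x : W.obj i) :
    (app j).app ((W.map f).toFunctor.obj x) ≫ (d.nat f x).hom =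
      (c.nat f x).hom ≫ (app i).app x ▷ D.map f

/-- The category of `W`-weighted cones over `D` with vertex `X`. -/
instance : Category (CatWeightedCone W D X) where
  Hom := Hom
  id c := { app := fun j => 𝟙 (c.app j), comm := by intros; simp }
  comp a b :=
    { app := fun j => a.app j ≫ b.app j
      comm := by
        intro i j f x
        simp only [NatTrans.comp_app, Category.assoc, comp_whiskerRight, b.comm f x]
        rw [← Category.assoc, a.comm f x, Category.assoc] }
  id_comp a := by apply Hom.ext; funext j; exact Category.id_comp _
  comp_id a := by apply Hom.ext; funext j; exact Category.comp_id _
  assoc a b c := by apply Hom.ext; funext j; exact Category.assoc _ _ _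

/-- Restriction of a weighted cone with vertex `X` along a `1`-cell `h : Y ⟶ X`. -/
def precomp (c : CatWeightedCone W D X) (h : Y ⟶ X) : CatWeightedCone W D Y where
  app j := c.app j ⋙ Bicategory.precomp (D.obj j) h
  nat f x := whiskerLeftIso h (c.nat f x) ≪≫ (α_ h ((c.app _).obj x) (D.map f)).symm
  nat_naturality {i j} f x y u := by
    have := congrArg (fun t => h ◁ t) (c.nat_naturality f u)
    simp only [Bicategory.whiskerLeft_comp] at this
    change h ◁ (c.app j).map ((W.map f).toFunctor.map u) ≫ h ◁ (c.nat f y).hom ≫ (α_ _ _ _).inv =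
      (h ◁ (c.nat f x).hom ≫ (α_ _ _ _).inv) ≫ (h ◁ (c.app i).map u) ▷ D.map f
    simp [reassoc_of% this]
  nat_map₂ {i j f g} η x := by
    have := congrArg (fun t => h ◁ t) (c.nat_map₂ η x)
    simp only [Bicategory.whiskerLeft_comp] at this
    change h ◁ (c.app j).map ((W.map₂ η).toNatTrans.app x) ≫ h ◁ (c.nat g x).hom ≫ (α_ _ _ _).inv =
      (h ◁ (c.nat f x).hom ≫ (α_ _ _ _).inv) ≫ (h ≫ (c.app i).obj x) ◁ D.map₂ η
    simp [reassoc_of% this]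
  nat_id i x := by
    have := congrArg (fun t => h ◁ t) (c.nat_id i x)
    simp only [Bicategory.whiskerLeft_comp] at this
    change (h ◁ (c.nat (𝟙 i) x).hom ≫ (α_ _ _ _).inv) ≫
      (h ≫ (c.app i).obj x) ◁ (D.mapId i).hom ≫ (ρ_ (h ≫ (c.app i).obj x)).hom =
        h ◁ (c.app i).map ((W.mapId i).hom.toNatTrans.app x)
    simpa using this
  nat_comp {i j k} f g x := by
    have := congrArg (fun t => h ◁ t) (c.nat_comp f g x)
    simp only [Bicategory.whiskerLeft_comp] at this
    change (h ◁ (c.nat (f ≫ g) x).hom ≫ (α_ _ _ _).inv) ≫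
        (h ≫ (c.app i).obj x) ◁ (D.mapComp f g).hom =
      h ◁ (c.app k).map ((W.mapComp f g).hom.toNatTrans.app x) ≫
        (h ◁ (c.nat g ((W.map f).toFunctor.obj x)).hom ≫ (α_ _ _ _).inv) ≫
          (h ◁ (c.nat f x).hom ≫ (α_ _ _ _).inv) ▷ D.map g ≫
            (α_ (h ≫ (c.app i).obj x) (D.map f) (D.map g)).hom
    simp [reassoc_of% this]

/-- The comparison functor `Hom (Y, X) ⥤ Cone (Y)` induced by a weighted cone with vertex `X`. -/
def comparison (c : CatWeightedCone W D X) (Y : B) : (Y ⟶ X) ⥤ CatWeightedCone W D Y where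
  obj h := c.precomp h
  map {h k} θ :=
    { app := fun j => { app := fun x => θ ▷ (c.app j).obj x
                        naturality := fun x y u => whisker_exchange θ ((c.app j).map u) }
      comm := by
        intro i j f x
        have := whisker_exchange θ (c.nat f x).hom
        change θ ▷ (c.app j).obj ((W.map f).toFunctor.obj x) ≫ k ◁ (c.nat f x).hom ≫ (α_ _ _ _).inv =
          (h ◁ (c.nat f x).hom ≫ (α_ _ _ _).inv) ≫ θ ▷ (c.app i).obj x ▷ D.map f
        simp [← reassoc_of% this] }
  map_id h := by
    apply Hom.ext; funext j; ext x
    exact id_whiskerRight _ _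
  map_comp a b := by
    apply Hom.ext; funext j; ext x
    exact comp_whiskerRight _ _ _

/-- A weighted cone is a (bicategorical) `W`-weighted limit of `D` if, for every `Y`, the
comparison functor `Hom (Y, X) ⥤ Cone (Y)` is an equivalence of categories. -/
def IsLimit (c : CatWeightedCone W D X) : Prop :=
  ∀ Y : B, (c.comparison Y).IsEquivalence

/-- A weighted cone is strict if all its naturality constraints are identities. Between strict
`2`-functors `W` and `D`, these are the `2`-natural transformations `W ⟶ Hom (X, D -)`. -/
def IsStrict (c : CatWeightedCone W D X) : Prop :=
  ∀ {i j : J} (f : i ⟶ j) (x : W.obj i),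
    ∃ h : (c.app j).obj ((W.map f).toFunctor.obj x) = (c.app i).obj x ≫ D.map f,
      c.nat f x = eqToIso h

/-- A strict weighted cone is a strict (that is, `Cat`-enriched) `W`-weighted limit of `D` if,
for every `Y`, the comparison functor is an isomorphism from `Hom (Y, X)` onto the category of
strict weighted cones with vertex `Y`: it is full, faithful and bijective on objects. -/
def IsStrictLimit (c : CatWeightedCone W D X) : Prop :=
  c.IsStrict ∧ ∀ Y : B, (c.comparison Y).Full ∧ (c.comparison Y).Faithful ∧
    ∀ d : CatWeightedCone W D Y, d.IsStrict → ∃! h : Y ⟶ X, (c.comparison Y).obj h = d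

/-- The image of a weighted cone under a pseudofunctor. -/
def map (F : Pseudofunctor B C) (c : CatWeightedCone W D X) :
    CatWeightedCone W (D.comp F) (F.obj X) where
  app j := c.app j ⋙ F.mapFunctor X (D.obj j)
  nat f x := F.map₂Iso (c.nat f x) ≪≫ F.mapComp ((c.app _).obj x) (D.map f)
  nat_naturality {i j} f x y u := by
    have := congrArg (fun t => F.map₂ t) (c.nat_naturality f u)
    simp only [PrelaxFunctor.map₂_comp] at this
    change F.map₂ ((c.app j).map ((W.map f).toFunctor.map u)) ≫
        F.map₂ (c.nat f y).hom ≫ (F.mapComp ((c.app i).obj y) (D.map f)).hom =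
      (F.map₂ (c.nat f x).hom ≫ (F.mapComp ((c.app i).obj x) (D.map f)).hom) ≫
        F.map₂ ((c.app i).map u) ▷ F.map (D.map f)
    simp [reassoc_of% this]
  nat_map₂ {i j f g} η x := by
    have := congrArg (fun t => F.map₂ t) (c.nat_map₂ η x)
    simp only [PrelaxFunctor.map₂_comp] at this
    change F.map₂ ((c.app j).map ((W.map₂ η).toNatTrans.app x)) ≫
        F.map₂ (c.nat g x).hom ≫ (F.mapComp ((c.app i).obj x) (D.map g)).hom =
      (F.map₂ (c.nat f x).hom ≫ (F.mapComp ((c.app i).obj x) (D.map f)).hom) ≫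
        F.map ((c.app i).obj x) ◁ F.map₂ (D.map₂ η)
    simp [reassoc_of% this]
  nat_id i x := by
    have := congrArg (fun t => F.map₂ t) (c.nat_id i x)
    simp only [PrelaxFunctor.map₂_comp] at this
    change (F.map₂ (c.nat (𝟙 i) x).hom ≫ (F.mapComp ((c.app i).obj x) (D.map (𝟙 i))).hom) ≫
        F.map ((c.app i).obj x) ◁ (F.map₂ (D.mapId i).hom ≫ (F.mapId (D.obj i)).hom) ≫
          (ρ_ (F.map ((c.app i).obj x))).hom =
      F.map₂ ((c.app i).map ((W.mapId i).hom.toNatTrans.app x))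
    simpa using this
  nat_comp {i j k} f g x := by
    have := congrArg (fun t => F.map₂ t) (c.nat_comp f g x)
    simp only [PrelaxFunctor.map₂_comp] at this
    change (F.map₂ (c.nat (f ≫ g) x).hom ≫ (F.mapComp ((c.app i).obj x) (D.map (f ≫ g))).hom) ≫
        F.map ((c.app i).obj x) ◁
          (F.map₂ (D.mapComp f g).hom ≫ (F.mapComp (D.map f) (D.map g)).hom) =
      F.map₂ ((c.app k).map ((W.mapComp f g).hom.toNatTrans.app x)) ≫
        (F.map₂ (c.nat g ((W.map f).toFunctor.obj x)).hom ≫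
          (F.mapComp ((c.app j).obj ((W.map f).toFunctor.obj x)) (D.map g)).hom) ≫
        (F.map₂ (c.nat f x).hom ≫ (F.mapComp ((c.app i).obj x) (D.map f)).hom) ▷ F.map (D.map g) ≫
          (α_ (F.map ((c.app i).obj x)) (F.map (D.map f)) (F.map (D.map g))).hom
    have e : F.map ((c.app i).obj x) ◁ F.map₂ (D.mapComp f g).hom =
      (F.mapComp ((c.app i).obj x) (D.map (f ≫ g))).inv ≫
        F.map₂ ((c.app i).obj x ◁ (D.mapComp f g).hom) ≫
          (F.mapComp ((c.app i).obj x) (D.map f ≫ D.map g)).hom := by simp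
    rw [Bicategory.whiskerLeft_comp, e]
    simp only [Category.assoc, Iso.hom_inv_id_assoc, reassoc_of% this]
    simp

end CatWeightedCone

end WeightedLimits

/-! ## The arrow 2-category of `CAT` -/

/-- An object of `CAT^2`: a functor between locally small categories. -/
structure ArrCAT where
  /-- the domain -/
  dom : Type (w + 1)
  /-- the codomain -/
  cod : Type (w + 1)
  [catDom : Category.{w} dom]
  [catCod : Category.{w} cod]
  /-- the functor itself -/
  fn : dom ⥤ cod

namespace ArrCAT

attribute [instance] catDom catCod

/-- A `1`-cell of `CAT^2`: a square of functors commuting up to a specified natural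
isomorphism. -/
@[ext]
structure Sq (X Y : ArrCAT.{w}) where
  /-- the functor between the domains -/
  top : X.dom ⥤ Y.dom
  /-- the functor between the codomains -/
  bot : X.cod ⥤ Y.cod
  /-- the invertible `2`-cell filling the square -/
  iso : X.fn ⋙ bot ≅ top ⋙ Y.fn

/-- A `2`-cell of `CAT^2`: a pair of natural transformations compatible with the isomorphisms
filling the squares. -/
@[ext]
structure SqHom {X Y : ArrCAT.{w}} (S T : Sq X Y) where
  /-- the transformation between the functors on domains -/
  top : S.top ⟶ T.top
  /-- the transformation between the functors on codomains -/
  bot : S.bot ⟶ T.bot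
  comm (x : X.dom) :
    bot.app (X.fn.obj x) ≫ T.iso.hom.app x = S.iso.hom.app x ≫ Y.fn.map (top.app x)

variable {X Y Z : ArrCAT.{w}}

instance : Category (Sq X Y) where
  Hom := SqHom
  id S := { top := 𝟙 _, bot := 𝟙 _, comm := by intro x; simp }
  comp a b :=
    { top := a.top ≫ b.top
      bot := a.bot ≫ b.bot
      comm := by intro x; simp [b.comm x, reassoc_of% a.comm x] }
  id_comp a := by apply SqHom.ext <;> exact Category.id_comp _
  comp_id a := by apply SqHom.ext <;> exact Category.comp_id _
  assoc a b c := by apply SqHom.ext <;> exact Category.assoc _ _ _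

/-- An isomorphism of squares from compatible isomorphisms of functors. -/
def Sq.isoMk {S T : Sq X Y} (t : S.top ≅ T.top) (b : S.bot ≅ T.bot)
    (comm : ∀ x : X.dom, b.hom.app (X.fn.obj x) ≫ T.iso.hom.app x =
      S.iso.hom.app x ≫ Y.fn.map (t.hom.app x)) : S ≅ T where
  hom := ⟨t.hom, b.hom, comm⟩
  inv := ⟨t.inv, b.inv, fun x => by
    rw [← cancel_epi (b.hom.app (X.fn.obj x)), ← Category.assoc, ← NatTrans.comp_app,
      b.hom_inv_id, ← Category.assoc, comm, Category.assoc, ← Functor.map_comp,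
      ← NatTrans.comp_app, t.hom_inv_id]
    simp⟩
  hom_inv_id := by apply SqHom.ext <;> exact Iso.hom_inv_id _
  inv_hom_id := by apply SqHom.ext <;> exact Iso.inv_hom_id _

/-- The identity square. -/
def Sq.id (X : ArrCAT.{w}) : Sq X X where
  top := 𝟭 _
  bot := 𝟭 _
  iso := NatIso.ofComponents (fun x => Iso.refl (X.fn.obj x)) (by intros; simp)

/-- Pasting of squares. -/
def Sq.comp (S : Sq X Y) (T : Sq Y Z) : Sq X Z where
  top := S.top ⋙ T.top
  bot := S.bot ⋙ T.bot
  iso := NatIso.ofComponents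
    (fun x => T.bot.mapIso (S.iso.app x) ≪≫ T.iso.app (S.top.obj x))
    (by
      intro x y f
      have h₁ := S.iso.hom.naturality f
      have h₂ := T.iso.hom.naturality (S.top.map f)
      dsimp at h₁ h₂ ⊢
      rw [Category.assoc, ← h₂, ← Category.assoc, ← T.bot.map_comp, h₁]
      simp)

/-- Whiskering of a `2`-cell by a square on the left. -/
def Sq.whiskerLeft (S : Sq X Y) {T T' : Sq Y Z} (η : T ⟶ T') : S.comp T ⟶ S.comp T' :=
  SqHom.mk (S := S.comp T) (T := S.comp T') (Functor.whiskerLeft S.top η.top)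
    (Functor.whiskerLeft S.bot η.bot) (by
      intro x
      have h₁ := η.comm (S.top.obj x)
      have h₂ := η.bot.naturality (S.iso.hom.app x)
      dsimp [Sq.comp] at h₁ h₂ ⊢
      rw [← Category.assoc, ← h₂, Category.assoc, h₁, Category.assoc])

/-- Whiskering of a `2`-cell by a square on the right. -/
def Sq.whiskerRight {S S' : Sq X Y} (η : S ⟶ S') (T : Sq Y Z) : S.comp T ⟶ S'.comp T :=
  SqHom.mk (S := S.comp T) (T := S'.comp T) (Functor.whiskerRight η.top T.top)
    (Functor.whiskerRight η.bot T.bot) (by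
      intro x
      have h₁ := congrArg (fun t => T.bot.map t) (η.comm x)
      have h₂ := T.iso.hom.naturality (η.top.app x)
      dsimp [Sq.comp] at h₁ h₂ ⊢
      rw [T.bot.map_comp, T.bot.map_comp] at h₁
      rw [← Category.assoc, h₁, Category.assoc, h₂, Category.assoc])

/-- The associator for pasting of squares; its components are identities. -/
def Sq.associator {V : ArrCAT.{w}} (S : Sq X Y) (T : Sq Y Z) (U : Sq Z V) :
    (S.comp T).comp U ≅ S.comp (T.comp U) :=
  Sq.isoMk (S := (S.comp T).comp U) (T := S.comp (T.comp U))
    (Functor.associator _ _ _) (Functor.associator _ _ _) (by intro x; simp [Sq.comp])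

/-- The left unitor for pasting of squares; its components are identities. -/
def Sq.leftUnitor (S : Sq X Y) : (Sq.id X).comp S ≅ S :=
  Sq.isoMk (S := (Sq.id X).comp S) (T := S)
    (Functor.leftUnitor _) (Functor.leftUnitor _) (by intro x; simp [Sq.comp, Sq.id])

/-- The right unitor for pasting of squares; its components are identities. -/
def Sq.rightUnitor (S : Sq X Y) : S.comp (Sq.id Y) ≅ S :=
  Sq.isoMk (S := S.comp (Sq.id Y)) (T := S)
    (Functor.rightUnitor _) (Functor.rightUnitor _) (by intro x; simp [Sq.comp, Sq.id])

/-- The `2`-category `CAT^2`. -/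
instance : Bicategory ArrCAT.{w} where
  Hom X Y := Sq X Y
  id X := Sq.id X
  comp S T := Sq.comp S T
  homCategory X Y := inferInstanceAs (Category (Sq X Y))
  whiskerLeft S _ _ η := Sq.whiskerLeft S η
  whiskerRight η T := Sq.whiskerRight η T
  associator S T U := Sq.associator S T U
  leftUnitor S := Sq.leftUnitor S
  rightUnitor S := Sq.rightUnitor S
  whiskerLeft_id S T := by apply SqHom.ext <;> exact Functor.whiskerLeft_id' _
  whiskerLeft_comp S _ _ _ η θ := by apply SqHom.ext <;> exact Functor.whiskerLeft_comp _ _ _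
  id_whiskerLeft η := by
    apply SqHom.ext <;> ext <;> exact ((Category.id_comp _).trans (Category.comp_id _)).symm
  comp_whiskerLeft S T _ _ η := by
    apply SqHom.ext <;> ext <;> exact ((Category.id_comp _).trans (Category.comp_id _)).symm
  id_whiskerRight S T := by apply SqHom.ext <;> exact Functor.whiskerRight_id' _
  comp_whiskerRight η θ S := by apply SqHom.ext <;> exact Functor.whiskerRight_comp _ _ _
  whiskerRight_id η := by
    apply SqHom.ext <;> ext <;> exact ((Category.id_comp _).trans (Category.comp_id _)).symm
  whiskerRight_comp η S T := by
    apply SqHom.ext <;> ext <;> exact ((Category.id_comp _).trans (Category.comp_id _)).symm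
  whisker_assoc S _ _ η T := by
    apply SqHom.ext <;> ext <;> exact ((Category.id_comp _).trans (Category.comp_id _)).symm
  whisker_exchange η θ := by
    apply SqHom.ext
    · ext x; exact (θ.top.naturality (η.top.app x)).symm
    · ext x; exact (θ.bot.naturality (η.bot.app x)).symm
  pentagon S T U V := by apply SqHom.ext <;> exact Functor.pentagon _ _ _ _
  triangle S T := by apply SqHom.ext <;> exact Functor.triangle _ _

theorem Sq.eq_of_iso {S T : Sq X Y} (ht : S.top = T.top) (hb : S.bot = T.bot)
    (h : ∀ x, eqToHom (by rw [hb]) ≫ T.iso.hom.app x =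
      S.iso.hom.app x ≫ eqToHom (by rw [ht])) : S = T := by
  obtain ⟨t, b, i⟩ := S
  obtain ⟨t', b', i'⟩ := T
  obtain rfl : t = t' := ht
  obtain rfl : b = b' := hb
  congr 1
  ext x : 3
  simpa using (h x).symm

theorem Sq.eqToHom_top {S T : Sq X Y} (h : S = T) :
    SqHom.top (eqToHom h) = eqToHom (congrArg Sq.top h) := by
  subst h; rfl

theorem Sq.eqToHom_bot {S T : Sq X Y} (h : S = T) :
    SqHom.bot (eqToHom h) = eqToHom (congrArg Sq.bot h) := by
  subst h; rfl

theorem Sq.isoMk_eq_eqToIso {S T : Sq X Y} (h : S = T) (t : S.top ≅ T.top) (b : S.bot ≅ T.bot)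
    (comm) (ht : t.hom = eqToHom (congrArg Sq.top h)) (hb : b.hom = eqToHom (congrArg Sq.bot h)) :
    Sq.isoMk t b comm = eqToIso h := by
  apply Iso.ext
  apply SqHom.ext
  · exact ht.trans (Sq.eqToHom_top h).symm
  · exact hb.trans (Sq.eqToHom_bot h).symm

theorem Sq.comp_assoc' {V : ArrCAT.{w}} (S : Sq X Y) (T : Sq Y Z) (U : Sq Z V) :
    (S.comp T).comp U = S.comp (T.comp U) :=
  Sq.eq_of_iso rfl rfl (by intro x; simp [Sq.comp]; exact Category.id_comp _)

theorem Sq.id_comp' (S : Sq X Y) : (Sq.id X).comp S = S :=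
  Sq.eq_of_iso rfl rfl (by intro x; simp [Sq.comp, Sq.id]; exact Category.id_comp _)

theorem Sq.comp_id' (S : Sq X Y) : S.comp (Sq.id Y) = S :=
  Sq.eq_of_iso rfl rfl (by intro x; simp [Sq.comp, Sq.id]; exact Category.id_comp _)

instance : Bicategory.Strict ArrCAT.{w} where
  id_comp S := Sq.id_comp' S
  comp_id S := Sq.comp_id' S
  assoc S T U := Sq.comp_assoc' S T U
  leftUnitor_eqToIso S := Sq.isoMk_eq_eqToIso (Sq.id_comp' S) _ _ _ rfl rfl
  rightUnitor_eqToIso S := Sq.isoMk_eq_eqToIso (Sq.comp_id' S) _ _ _ rfl rfl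
  associator_eqToIso S T U := Sq.isoMk_eq_eqToIso (Sq.comp_assoc' S T U) _ _ _ rfl rfl

end ArrCAT

/-! ## Categories with arities -/

open Limits Presheaf Functor

/-- A category with arities `(A, E, I)`: a locally small category `E` together with a small,
full and dense subcategory `I : A ⥤ E`. -/
structure CatWithArities where
  /-- the small category of arities -/
  A : Type w
  /-- the ambient locally small category -/
  E : Type (w + 1)
  [catA : Category.{w} A]
  [catE : Category.{w} E]
  /-- the inclusion of the arities -/
  I : A ⥤ E
  [full : I.Full]
  [faithful : I.Faithful]
  [dense : I.IsDense]

namespace CatWithArities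

attribute [instance] catA catE full faithful dense

variable (X Y Z : CatWithArities.{w})

/-- The category `Â` of presheaves of sets on the category of arities. -/
abbrev Psh : Type (w + 1) := X.Aᵒᵖ ⥤ Type w

/-- The nerve functor `N_I : E ⥤ Â`, `N_I e = E (I -, e)`. -/
abbrev nerve : X.E ⥤ X.Psh := restrictedULiftYoneda.{w} X.I

/-- The Yoneda embedding `A ⥤ Â`. -/
abbrev yo : X.A ⥤ X.Psh := uliftYoneda.{w}

/-- The nerve functor as an object of `CAT^2`. -/
abbrev toArr : ArrCAT.{w} where
  dom := X.E
  cod := X.Psh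
  fn := X.nerve

variable {X Y Z}

/-- The left Kan extension `Lan_y (N_J ∘ K ∘ I) : Â ⥤ B̂` of a functor `K : E ⥤ F` along the Yoneda
embedding. -/
noncomputable abbrev bar (K : X.E ⥤ Y.E) : X.Psh ⥤ Y.Psh :=
  X.yo.leftKanExtension (X.I ⋙ K ⋙ Y.nerve)

/-- A functor `K : E ⥤ F` respects arities if the square formed by `K`, the nerve functors and
`Lan_y (N_J ∘ K ∘ I)` commutes up to natural isomorphism. -/
def RespectsArities (K : X.E ⥤ Y.E) : Prop :=
  Nonempty (X.nerve ⋙ bar K ≅ K ⋙ Y.nerve)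

variable (X) in
/-- Since `I` is fully faithful, `y ≅ N_I ∘ I`. -/
noncomputable def yoIso : X.yo ≅ X.I ⋙ X.nerve :=
  NatIso.ofComponents
    (fun a => NatIso.ofComponents
      (fun b => Equiv.toIso
        { toFun := fun f => ULift.up (X.I.map f.down)
          invFun := fun f => ULift.up (X.I.preimage f.down)
          left_inv := fun f => by simp
          right_inv := fun f => by simp; rfl })
      (by
        intro b c f
        ext g
        apply ULift.down_injective
        exact X.I.map_comp _ _))
    (by
      intro a b f
      ext c g
      apply ULift.down_injective
      exact X.I.map_comp _ _)

variable (X) in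
theorem yoIso_comp (a : X.A) (e : X.E) (f : X.I.obj a ⟶ e) :
    X.yoIso.hom.app a ≫ X.nerve.map f = uliftYonedaEquiv.symm (ULift.up f) := by
  ext c g
  rfl

theorem isKan_of_preserves (G : X.Psh ⥤ Y.Psh) [PreservesColimitsOfSize.{w, w} G] :
    G.IsLeftKanExtension (𝟙 (X.yo ⋙ G)) :=
  isLeftKanExtension_of_preservesColimits G (Iso.refl _)

/-- Transformations out of `G ∘ N_I` with `G` cocontinuous are determined by their restriction
to the arities. -/
theorem nerve_hom_ext {G : X.Psh ⥤ Y.Psh} [PreservesColimitsOfSize.{w, w} G]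
    {H : X.E ⥤ Y.Psh} {δ δ' : X.nerve ⋙ G ⟶ H}
    (h : ∀ a : X.A, δ.app (X.I.obj a) = δ'.app (X.I.obj a)) : δ = δ' := by
  ext e : 2
  apply (isColimitOfPreserves G (colimitOfRepresentable.{w} (X.nerve.obj e))).hom_ext
  intro j
  have key : ∀ φ : X.nerve ⋙ G ⟶ H,
      (G.mapCocone (coconeOfRepresentable.{w} (X.nerve.obj e))).ι.app j ≫ φ.app e =
        G.map (X.yoIso.hom.app _) ≫ φ.app _ ≫ H.map (j.unop.snd).down := by
    intro φ
    rw [← φ.naturality, Functor.comp_map, ← G.map_comp_assoc, X.yoIso_comp]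
    rfl
  rw [key δ, key δ', h]

/-- If `G` is cocontinuous, restriction along `N_I` is bijective on transformations `G ⟶ H`. -/
theorem existsUnique_extension (G H : X.Psh ⥤ Y.Psh) [PreservesColimitsOfSize.{w, w} G]
    (γ : X.nerve ⋙ G ⟶ X.nerve ⋙ H) :
    ∃! β : G ⟶ H, ∀ e : X.E, β.app (X.nerve.obj e) = γ.app e := by
  have := isKan_of_preserves G
  let θ : X.yo ⋙ G ⟶ X.yo ⋙ H :=
    Functor.whiskerRight X.yoIso.hom G ≫ Functor.whiskerLeft X.I γ ≫
      Functor.whiskerRight X.yoIso.inv H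
  have hd : ∀ a, (G.descOfIsLeftKanExtension (𝟙 _) H θ).app (X.yo.obj a) = θ.app a := by
    intro a
    have := G.descOfIsLeftKanExtension_fac_app (𝟙 (X.yo ⋙ G)) H θ a
    simpa using this
  have hI : ∀ (β : G ⟶ H), (∀ a, β.app (X.yo.obj a) = θ.app a) ↔
      ∀ a, β.app (X.nerve.obj (X.I.obj a)) = γ.app (X.I.obj a) := by
    intro β
    refine forall_congr' fun a => ?_
    have hn := β.naturality (X.yoIso.hom.app a)
    have hθ : θ.app a ≫ H.map (X.yoIso.hom.app a) =
        G.map (X.yoIso.hom.app a) ≫ γ.app (X.I.obj a) := by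
      change (G.map (X.yoIso.hom.app a) ≫ γ.app (X.I.obj a) ≫ H.map (X.yoIso.inv.app a)) ≫ _ = _
      rw [Category.assoc, Category.assoc, ← H.map_comp, Iso.inv_hom_id_app]
      erw [H.map_id, Category.comp_id]
    constructor
    · intro h
      rw [h, hθ] at hn
      exact (cancel_epi (G.map (X.yoIso.hom.app a))).1 hn
    · intro h
      apply (cancel_mono (H.map (X.yoIso.hom.app a))).1
      rw [hθ, ← hn]
      exact congrArg (fun t => G.map (X.yoIso.hom.app a) ≫ t) h
  refine ⟨G.descOfIsLeftKanExtension (𝟙 _) H θ, ?_, ?_⟩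
  · intro e
    have h := (hI _).1 hd
    exact congrArg (fun t => NatTrans.app t e)
      (nerve_hom_ext (δ := Functor.whiskerLeft X.nerve (G.descOfIsLeftKanExtension (𝟙 _) H θ))
        (δ' := γ) h)
  · intro β hβ
    apply G.hom_ext_of_isLeftKanExtension (𝟙 (X.yo ⋙ G))
    ext a : 2
    have h₁ := (hI β).2 (fun a => hβ _) a
    have h₂ := hd a
    simpa using h₁.trans h₂.symm

/-- In a square over nerve functors with `G` cocontinuous, `G` is the left Kan extension above; in
particular, the functor on top respects arities. -/
theorem respectsArities_of_iso (K : X.E ⥤ Y.E) (G : X.Psh ⥤ Y.Psh)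
    [PreservesColimitsOfSize.{w, w} G] (e : X.nerve ⋙ G ≅ K ⋙ Y.nerve) : RespectsArities K :=
  ⟨Functor.isoWhiskerLeft X.nerve (uniqueExtensionAlongULiftYoneda.{w} G
      (Functor.isoWhiskerLeft X.I e.symm ≪≫ Functor.isoWhiskerRight X.yoIso.symm G)).symm ≪≫ e⟩

/-- A `1`-cell of `CwA`: an arities-respecting functor. -/
@[ext]
structure Hom (X Y : CatWithArities.{w}) where
  /-- the underlying functor -/
  functor : X.E ⥤ Y.E
  respects : RespectsArities functor

instance : Category (Hom X Y) where
  Hom K L := K.functor ⟶ L.functor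
  id K := 𝟙 K.functor
  comp α β := CategoryStruct.comp (obj := X.E ⥤ Y.E) α β
  id_comp α := Category.id_comp (obj := X.E ⥤ Y.E) α
  comp_id α := Category.comp_id (obj := X.E ⥤ Y.E) α
  assoc α β γ := Category.assoc (obj := X.E ⥤ Y.E) α β γ

/-- A `2`-isomorphism of `CwA` from an isomorphism of functors. -/
def Hom.isoMk {K L : Hom X Y} (e : K.functor ≅ L.functor) : K ≅ L where
  hom := e.hom
  inv := e.inv
  hom_inv_id := e.hom_inv_id
  inv_hom_id := e.inv_hom_id

/-- The identity `1`-cell. -/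
def Hom.id (X : CatWithArities.{w}) : Hom X X where
  functor := 𝟭 X.E
  respects := respectsArities_of_iso _ (𝟭 X.Psh) (Iso.refl X.nerve)

theorem RespectsArities.comp {K : X.E ⥤ Y.E} {L : Y.E ⥤ Z.E} (hK : RespectsArities K)
    (hL : RespectsArities L) : RespectsArities (K ⋙ L) := by
  obtain ⟨a⟩ := hK
  obtain ⟨b⟩ := hL
  have h₁ : PreservesColimitsOfSize.{w, w} (bar K) := preservesColimitsOfSize_leftKanExtension.{w} _
  have h₂ : PreservesColimitsOfSize.{w, w} (bar L) := preservesColimitsOfSize_leftKanExtension.{w} _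
  exact respectsArities_of_iso _ (bar K ⋙ bar L)
    (Functor.isoWhiskerRight a (bar L) ≪≫ Functor.isoWhiskerLeft K b)

/-- Composition of `1`-cells. -/
def Hom.comp (K : Hom X Y) (L : Hom Y Z) : Hom X Z where
  functor := K.functor ⋙ L.functor
  respects := K.respects.comp L.respects

/-- The `2`-category `CwA` of categories with arities: `1`-cells are the arities-respecting
functors, `2`-cells are all natural transformations. -/
instance : Bicategory CatWithArities.{w} where
  Hom X Y := Hom X Y
  id X := Hom.id X
  comp K L := Hom.comp K L
  homCategory X Y := inferInstanceAs (Category (Hom X Y))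
  whiskerLeft K _ _ η := Functor.whiskerLeft K.functor η
  whiskerRight η L := Functor.whiskerRight η L.functor
  associator K L M := Hom.isoMk (Functor.associator K.functor L.functor M.functor)
  leftUnitor K := Hom.isoMk (Functor.leftUnitor K.functor)
  rightUnitor K := Hom.isoMk (Functor.rightUnitor K.functor)
  whiskerLeft_id S T := Functor.whiskerLeft_id' _
  whiskerLeft_comp S _ _ _ η θ := Functor.whiskerLeft_comp _ _ _
  id_whiskerLeft η := by
    apply NatTrans.ext; ext; exact ((Category.id_comp _).trans (Category.comp_id _)).symm
  comp_whiskerLeft S T _ _ η := by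
    apply NatTrans.ext; ext; exact ((Category.id_comp _).trans (Category.comp_id _)).symm
  id_whiskerRight S T := Functor.whiskerRight_id' _
  comp_whiskerRight η θ S := Functor.whiskerRight_comp _ _ _
  whiskerRight_id η := by
    apply NatTrans.ext; ext; exact ((Category.id_comp _).trans (Category.comp_id _)).symm
  whiskerRight_comp η S T := by
    apply NatTrans.ext; ext; exact ((Category.id_comp _).trans (Category.comp_id _)).symm
  whisker_assoc S _ _ η T := by
    apply NatTrans.ext; ext; exact ((Category.id_comp _).trans (Category.comp_id _)).symm
  whisker_exchange η θ := by
    apply NatTrans.ext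
    ext x; exact (NatTrans.naturality θ (NatTrans.app η x)).symm
  pentagon S T U V := Functor.pentagon _ _ _ _
  triangle S T := Functor.triangle _ _

theorem Hom.eqToHom_eq {K L : Hom X Y} (h : K = L) :
    (eqToHom h : K ⟶ L) = (eqToHom (congrArg Hom.functor h) : K.functor ⟶ L.functor) := by
  subst h; rfl

instance : Bicategory.Strict CatWithArities.{w} where
  id_comp K := Hom.ext rfl
  comp_id K := Hom.ext rfl
  assoc K L M := Hom.ext rfl
  leftUnitor_eqToIso K := Iso.ext
    (Hom.eqToHom_eq (K := (Hom.id _).comp K) (L := K) (Hom.ext rfl)).symm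
  rightUnitor_eqToIso K := Iso.ext
    (Hom.eqToHom_eq (K := Hom.comp K (Hom.id _)) (L := K) (Hom.ext rfl)).symm
  associator_eqToIso K L M := Iso.ext
    (Hom.eqToHom_eq (K := (Hom.comp K L).comp M) (L := Hom.comp K (Hom.comp L M))
      (Hom.ext rfl)).symm

end CatWithArities

/-! ## Categories with arities and squares with cocontinuous right-hand side -/

/-- The objects of the `2`-category of categories with arities and cocontinuous squares: they are
the categories with arities. -/
@[ext]
structure CwASq where
  /-- the underlying category with arities -/
  arities : CatWithArities.{w}

namespace CwASq

open ArrCAT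

variable {X Y Z V : CwASq.{w}}

/-- A `1`-cell: a square over the nerve functors, commuting up to a specified isomorphism, in which
the functor between the presheaf categories is cocontinuous. -/
@[ext]
structure Hom (X Y : CwASq.{w}) extends Sq X.arities.toArr Y.arities.toArr where
  cocont : PreservesColimitsOfSize.{w, w} bot

instance : Category (Hom X Y) where
  Hom S T := S.toSq ⟶ T.toSq
  id S := 𝟙 S.toSq
  comp α β := CategoryStruct.comp (obj := Sq X.arities.toArr Y.arities.toArr) α β
  id_comp α := Category.id_comp (obj := Sq X.arities.toArr Y.arities.toArr) α
  comp_id α := Category.comp_id (obj := Sq X.arities.toArr Y.arities.toArr) α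
  assoc α β γ := Category.assoc (obj := Sq X.arities.toArr Y.arities.toArr) α β γ

/-- A `2`-isomorphism from an isomorphism of squares. -/
def Hom.isoMk {S T : Hom X Y} (e : S.toSq ≅ T.toSq) : S ≅ T where
  hom := e.hom
  inv := e.inv
  hom_inv_id := e.hom_inv_id
  inv_hom_id := e.inv_hom_id

/-- The identity `1`-cell. -/
def Hom.id (X : CwASq.{w}) : Hom X X where
  toSq := Sq.id _
  cocont := inferInstanceAs (PreservesColimitsOfSize.{w, w} (𝟭 X.arities.Psh))

/-- Composition of `1`-cells. -/
def Hom.comp (S : Hom X Y) (T : Hom Y Z) : Hom X Z where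
  toSq := S.toSq.comp T.toSq
  cocont :=
    have := S.cocont
    have := T.cocont
    inferInstanceAs (PreservesColimitsOfSize.{w, w} (S.bot ⋙ T.bot))

/-- The `2`-category of categories with arities and cocontinuous squares; its `2`-cells are
those of `CAT^2`. -/
instance : Bicategory CwASq.{w} where
  Hom X Y := Hom X Y
  id X := Hom.id X
  comp S T := Hom.comp S T
  homCategory X Y := inferInstanceAs (Category (Hom X Y))
  whiskerLeft S _ _ η := Sq.whiskerLeft S.toSq η
  whiskerRight η T := Sq.whiskerRight η T.toSq
  associator S T U := Hom.isoMk (Sq.associator S.toSq T.toSq U.toSq)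
  leftUnitor S := Hom.isoMk (Sq.leftUnitor S.toSq)
  rightUnitor S := Hom.isoMk (Sq.rightUnitor S.toSq)
  whiskerLeft_id S T := Bicategory.whiskerLeft_id (B := ArrCAT.{w}) S.toSq T.toSq
  whiskerLeft_comp S _ _ _ η θ := Bicategory.whiskerLeft_comp (B := ArrCAT.{w}) S.toSq η θ
  id_whiskerLeft η := Bicategory.id_whiskerLeft (B := ArrCAT.{w}) η
  comp_whiskerLeft S T _ _ η := Bicategory.comp_whiskerLeft (B := ArrCAT.{w}) S.toSq T.toSq η
  id_whiskerRight S T := Bicategory.id_whiskerRight (B := ArrCAT.{w}) S.toSq T.toSq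
  comp_whiskerRight η θ S := Bicategory.comp_whiskerRight (B := ArrCAT.{w}) η θ S.toSq
  whiskerRight_id η := Bicategory.whiskerRight_id (B := ArrCAT.{w}) η
  whiskerRight_comp η S T := Bicategory.whiskerRight_comp (B := ArrCAT.{w}) η S.toSq T.toSq
  whisker_assoc S _ _ η T := Bicategory.whisker_assoc (B := ArrCAT.{w}) S.toSq η T.toSq
  whisker_exchange η θ := Bicategory.whisker_exchange (B := ArrCAT.{w}) η θ
  pentagon S T U V :=
    Bicategory.pentagon (B := ArrCAT.{w}) S.toSq T.toSq U.toSq V.toSq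
  triangle S T := Bicategory.triangle (B := ArrCAT.{w}) S.toSq T.toSq

theorem Hom.ext' {S T : Hom X Y} (h : S.toSq = T.toSq) : S = T := by
  cases S; cases T; cases h; rfl

theorem Hom.eqToHom_eq {S T : Hom X Y} (h : S = T) :
    (eqToHom h : S ⟶ T) = (eqToHom (congrArg Hom.toSq h) : S.toSq ⟶ T.toSq) := by
  subst h; rfl

instance : Bicategory.Strict CwASq.{w} where
  id_comp S := Hom.ext' (Sq.id_comp' _)
  comp_id S := Hom.ext' (Sq.comp_id' _)
  assoc S T U := Hom.ext' (Sq.comp_assoc' _ _ _)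
  leftUnitor_eqToIso S := Iso.ext
    ((congrArg Iso.hom (Bicategory.Strict.leftUnitor_eqToIso (B := ArrCAT.{w}) S.toSq)).trans
      (Hom.eqToHom_eq (S := (Hom.id _).comp S) (T := S) (Hom.ext' (Sq.id_comp' _))).symm)
  rightUnitor_eqToIso S := Iso.ext
    ((congrArg Iso.hom (Bicategory.Strict.rightUnitor_eqToIso (B := ArrCAT.{w}) S.toSq)).trans
      (Hom.eqToHom_eq (S := Hom.comp S (Hom.id _)) (T := S) (Hom.ext' (Sq.comp_id' _))).symm)
  associator_eqToIso S T U := Iso.ext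
    ((congrArg Iso.hom (Bicategory.Strict.associator_eqToIso (B := ArrCAT.{w})
      S.toSq T.toSq U.toSq)).trans
      (Hom.eqToHom_eq (S := (Hom.comp S T).comp U) (T := Hom.comp S (Hom.comp T U))
        (Hom.ext' (Sq.comp_assoc' _ _ _))).symm)

/-- The strict `2`-functor to `CAT^2` sending a category with arities to its nerve functor; it is
the inclusion on `1`-cells and the identity on `2`-cells. -/
def toArrCAT : StrictPseudofunctor CwASq.{w} ArrCAT.{w} :=
  StrictPseudofunctor.mk''
    { obj := fun X => X.arities.toArr
      map := fun S => S.toSq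
      map₂ := fun η => η
      map₂_id := fun _ => rfl
      map₂_comp := fun _ _ => rfl
      map_id := fun _ => rfl
      map_comp := fun _ _ => rfl
      map₂_whisker_left := fun S _ _ η =>
        ((Category.id_comp (obj := Sq _ _) _).trans (Category.comp_id (obj := Sq _ _) _)).symm
      map₂_whisker_right := fun η S =>
        ((Category.id_comp (obj := Sq _ _) _).trans (Category.comp_id (obj := Sq _ _) _)).symm }

/-- `2`-cells are determined by their component on the ambient categories. -/
theorem hom₂_ext {S T : Hom X Y} {η θ : S ⟶ T} (h : SqHom.top η = SqHom.top θ) : η = θ := by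
  have := S.cocont
  let γ : X.arities.nerve ⋙ S.bot ⟶ X.arities.nerve ⋙ T.bot :=
    Functor.whiskerLeft X.arities.nerve (SqHom.bot η)
  obtain ⟨β, -, hβ⟩ := CatWithArities.existsUnique_extension S.bot T.bot γ
  apply SqHom.ext h
  refine (hβ _ fun e => rfl).trans (hβ _ fun e => ?_).symm
  have h₁ := SqHom.comm η e
  have h₂ := SqHom.comm θ e
  rw [h] at h₁
  exact (cancel_mono (T.iso.hom.app e)).1 (h₂.trans h₁.symm)

/-- Every transformation between the functors on the ambient categories underlies a `2`-cell. -/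
theorem exists_hom₂ (S T : Hom X Y) (α : S.top ⟶ T.top) : ∃ η : S ⟶ T, SqHom.top η = α := by
  have := S.cocont
  let γ : X.arities.nerve ⋙ S.bot ⟶ X.arities.nerve ⋙ T.bot :=
    S.iso.hom ≫ Functor.whiskerRight α Y.arities.nerve ≫ T.iso.inv
  obtain ⟨β, hβ, -⟩ := CatWithArities.existsUnique_extension S.bot T.bot γ
  refine ⟨SqHom.mk (S := S.toSq) (T := T.toSq) α β fun e => ?_, rfl⟩
  have h : β.app (X.arities.nerve.obj e) =
      S.iso.hom.app e ≫ Y.arities.nerve.map (α.app e) ≫ T.iso.inv.app e := hβ e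
  change β.app (X.arities.nerve.obj e) ≫ _ = S.iso.hom.app e ≫ Y.arities.nerve.map (α.app e)
  rw [h, Category.assoc, Category.assoc]
  erw [Iso.inv_hom_id_app, Category.comp_id]

/-- The unique `2`-cell with a given component on the ambient categories. -/
noncomputable def lift (S T : Hom X Y) (α : S.top ⟶ T.top) : S ⟶ T :=
  (exists_hom₂ S T α).choose

theorem lift_top (S T : Hom X Y) (α : S.top ⟶ T.top) : SqHom.top (lift S T α) = α :=
  (exists_hom₂ S T α).choose_spec

theorem lift_app (S T : Hom X Y) (α : S.top ⟶ T.top) (e : X.arities.E) :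
    (SqHom.top (lift S T α)).app e = α.app e :=
  congrArg (fun t => NatTrans.app t e) (lift_top S T α)

theorem hom₂_ext_app {S T : Hom X Y} {η θ : S ⟶ T}
    (h : ∀ e : X.arities.E, (SqHom.top η).app e = (SqHom.top θ).app e) : η = θ :=
  hom₂_ext (NatTrans.ext (funext h))

/-- The unique `2`-isomorphism with a given component on the ambient categories. -/
noncomputable def liftIso (S T : Hom X Y) (α : S.top ≅ T.top) : S ≅ T where
  hom := lift S T α.hom
  inv := lift T S α.inv
  hom_inv_id := hom₂_ext (by
    change SqHom.top (lift S T α.hom) ≫ SqHom.top (lift T S α.inv) = 𝟙 S.top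
    rw [lift_top, lift_top, α.hom_inv_id])
  inv_hom_id := hom₂_ext (by
    change SqHom.top (lift T S α.inv) ≫ SqHom.top (lift S T α.hom) = 𝟙 T.top
    rw [lift_top, lift_top, α.inv_hom_id])

end CwASq

namespace CatWithArities

variable {X Y Z : CatWithArities.{w}}

theorem conj_eq {C : Type*} [Category C] {a b : C} {x : a ⟶ a} {y y' : a ⟶ b} {z : b ⟶ b}
    (hx : x = 𝟙 a) (hy : y = y') (hz : z = 𝟙 b) : y' = x ≫ y ≫ z := by
  rw [hx, hy, hz, Category.id_comp, Category.comp_id]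

theorem comp₅_eq {C : Type*} [Category C] {a : C} {x y z u v : a ⟶ a} (hx : x = 𝟙 a)
    (hy : y = 𝟙 a) (hz : z = 𝟙 a) (hu : u = 𝟙 a) (hv : v = 𝟙 a) :
    𝟙 a = x ≫ y ≫ z ≫ u ≫ v := by
  simp [hx, hy, hz, hu, hv]

/-- The square `(K, Lan_y (N_J ∘ K ∘ I))` of an arities-respecting functor `K`. The isomorphism
filling it is a chosen one; by `CwASq.liftIso`, different choices give isomorphic squares. -/
noncomputable def Hom.toSq (K : Hom X Y) : CwASq.Hom ⟨X⟩ ⟨Y⟩ where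
  top := K.functor
  bot := bar K.functor
  iso := K.respects.some
  cocont := preservesColimitsOfSize_leftKanExtension.{w} _

/-- The pseudofunctor `(A, E, I) ↦ (A, E, I)`, `K ↦ (K, Lan_y (N_J ∘ K ∘ I))`. It sends a `2`-cell
`α` to the unique compatible pair of transformations extending `α`. -/
noncomputable def toCwASq : Pseudofunctor CatWithArities.{w} CwASq.{w} where
  obj X := ⟨X⟩
  map K := Hom.toSq K
  map₂ {X Y K L} α := CwASq.lift (Hom.toSq K) (Hom.toSq L) α
  map₂_id K := CwASq.hom₂_ext (CwASq.lift_top _ _ _)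
  map₂_comp {X Y K L M} α β := CwASq.hom₂_ext_app fun e =>
    (CwASq.lift_app (Hom.toSq K) (Hom.toSq M) (α ≫ β) e).trans
      (congrArg₂ (CategoryStruct.comp (obj := Y.E))
        (CwASq.lift_app (Hom.toSq K) (Hom.toSq L) α e)
        (CwASq.lift_app (Hom.toSq L) (Hom.toSq M) β e)).symm
  mapId X := CwASq.liftIso (Hom.toSq (Hom.id X)) (CwASq.Hom.id ⟨X⟩) (Iso.refl (𝟭 X.E))
  mapComp K L := CwASq.liftIso (Hom.toSq (Hom.comp K L))
    (CwASq.Hom.comp (Hom.toSq K) (Hom.toSq L)) (Iso.refl (K.functor ⋙ L.functor))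
  map₂_whisker_left {X Y Z} K {L M} η := CwASq.hom₂_ext_app fun e =>
    (CwASq.lift_app (Hom.toSq (Hom.comp K L)) (Hom.toSq (Hom.comp K M)) _ e).trans
      (conj_eq (CwASq.lift_app (Hom.toSq (Hom.comp K L))
          (CwASq.Hom.comp (Hom.toSq K) (Hom.toSq L)) (Iso.refl (K.functor ⋙ L.functor)).hom e)
        (CwASq.lift_app (Hom.toSq L) (Hom.toSq M) η (K.functor.obj e))
        (CwASq.lift_app (CwASq.Hom.comp (Hom.toSq K) (Hom.toSq M))
          (Hom.toSq (Hom.comp K M)) (Iso.refl (K.functor ⋙ M.functor)).inv e))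
  map₂_whisker_right {X Y Z K L} η M := CwASq.hom₂_ext_app fun e =>
    (CwASq.lift_app (Hom.toSq (Hom.comp K M)) (Hom.toSq (Hom.comp L M)) _ e).trans
      (conj_eq (CwASq.lift_app (Hom.toSq (Hom.comp K M))
          (CwASq.Hom.comp (Hom.toSq K) (Hom.toSq M)) (Iso.refl (K.functor ⋙ M.functor)).hom e)
        (congrArg (fun t => M.functor.map t) (CwASq.lift_app (Hom.toSq K) (Hom.toSq L) η e))
        (CwASq.lift_app (CwASq.Hom.comp (Hom.toSq L) (Hom.toSq M))
          (Hom.toSq (Hom.comp L M)) (Iso.refl (L.functor ⋙ M.functor)).inv e))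
  map₂_associator {X Y Z V} K L M := CwASq.hom₂_ext_app fun e =>
    (CwASq.lift_app (Hom.toSq (Hom.comp (Hom.comp K L) M))
      (Hom.toSq (Hom.comp K (Hom.comp L M))) _ e).trans
      (comp₅_eq (CwASq.lift_app (Hom.toSq (Hom.comp (Hom.comp K L) M))
          (CwASq.Hom.comp (Hom.toSq (Hom.comp K L)) (Hom.toSq M))
          (Iso.refl ((K.functor ⋙ L.functor) ⋙ M.functor)).hom e)
        ((congrArg (fun t => M.functor.map t) (CwASq.lift_app (Hom.toSq (Hom.comp K L))
          (CwASq.Hom.comp (Hom.toSq K) (Hom.toSq L))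
          (Iso.refl (K.functor ⋙ L.functor)).hom e)).trans (M.functor.map_id _))
        rfl
        (CwASq.lift_app (CwASq.Hom.comp (Hom.toSq L) (Hom.toSq M))
          (Hom.toSq (Hom.comp L M)) (Iso.refl (L.functor ⋙ M.functor)).inv (K.functor.obj e))
        (CwASq.lift_app (CwASq.Hom.comp (Hom.toSq K) (Hom.toSq (Hom.comp L M)))
          (Hom.toSq (Hom.comp K (Hom.comp L M)))
          (Iso.refl (K.functor ⋙ L.functor ⋙ M.functor)).inv e))
  map₂_left_unitor {X Y} K := CwASq.hom₂_ext_app fun e =>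
    (CwASq.lift_app (Hom.toSq (Hom.comp (Hom.id X) K)) (Hom.toSq K) _ e).trans
      (conj_eq (CwASq.lift_app (Hom.toSq (Hom.comp (Hom.id X) K))
          (CwASq.Hom.comp (Hom.toSq (Hom.id X)) (Hom.toSq K))
          (Iso.refl (𝟭 X.E ⋙ K.functor)).hom e)
        ((congrArg (fun t => K.functor.map t) (CwASq.lift_app (Hom.toSq (Hom.id X))
          (CwASq.Hom.id ⟨X⟩) (Iso.refl (𝟭 X.E)).hom e)).trans (K.functor.map_id _)) rfl)
  map₂_right_unitor {X Y} K := CwASq.hom₂_ext_app fun e =>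
    (CwASq.lift_app (Hom.toSq (Hom.comp K (Hom.id Y))) (Hom.toSq K) _ e).trans
      (conj_eq (CwASq.lift_app (Hom.toSq (Hom.comp K (Hom.id Y)))
          (CwASq.Hom.comp (Hom.toSq K) (Hom.toSq (Hom.id Y)))
          (Iso.refl (K.functor ⋙ 𝟭 Y.E)).hom e)
        (CwASq.lift_app (Hom.toSq (Hom.id Y)) (CwASq.Hom.id ⟨Y⟩) (Iso.refl (𝟭 Y.E)).hom
          (K.functor.obj e)) rfl)

/-- On hom-categories `toCwASq` is an equivalence; on objects it is a bijection. -/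
theorem toCwASq_isEquivalence (X Y : CatWithArities.{w}) :
    (toCwASq.mapFunctor X Y).IsEquivalence where
  faithful := ⟨fun {K L} α β h => by
    have := congrArg ArrCAT.SqHom.top h
    exact (CwASq.lift_top (Hom.toSq K) (Hom.toSq L) α).symm.trans
      (this.trans (CwASq.lift_top (Hom.toSq K) (Hom.toSq L) β))⟩
  full := ⟨fun {K L} η => ⟨ArrCAT.SqHom.top η, CwASq.hom₂_ext (CwASq.lift_top _ _ _)⟩⟩
  essSurj := ⟨fun S => by
    have := S.cocont
    exact ⟨(⟨S.top, respectsArities_of_iso S.top S.bot S.iso⟩ : Hom X Y),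
      ⟨CwASq.liftIso _ S (Iso.refl S.top)⟩⟩⟩

/-- The nerve `2`-functor `CwA ⥤ CAT^2`, sending `(A, E, I)` to `N_I : E ⥤ Â`, an
arities-respecting functor `K` to the square `(K, Lan_y (N_J ∘ K ∘ I))`, and a transformation `α` to
the unique compatible pair extending it. Since Kan extensions are defined up to isomorphism, it
preserves composition of `1`-cells up to coherent isomorphism. -/
noncomputable def toArrCAT : Pseudofunctor CatWithArities.{w} ArrCAT.{w} :=
  toCwASq.comp CwASq.toArrCAT.toPseudofunctor

end CatWithArities

/-! The inclusion of `CwA` (or of its strict model) into `CAT^2` is fully faithful on hom-categories,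
so it is enough to see that the square `(K, G, φ)` induced between nerve functors by a weighted cone
`d` on `D` comes from a `1`-cell of `CwA`. This holds as soon as `G` is cocontinuous, because `G` is
then a left Kan extension along the Yoneda embedding and `K` respects arities.

Cocontinuity of `G` is automatic. The functor `∅ ⥤ 1`, called `ArrCAT.point`, represents the
codomain category, so testing the limit property in `CAT^2` against it shows that the legs of the
limit cone are jointly conservative on presheaf categories
(`CatWeightedCone.isIso_of_isIso_bot_map`). The legs are cocontinuous, and so are their composites
with `G`, which agree (up to isomorphism) with the components of `d`. Hence each leg inverts the
comparison map from the colimit of `G ∘ F` to the image under `G` of the colimit of `F`; by joint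
conservativity this map is invertible (`CatWeightedCone.preservesColimits_bot`).

For limits up to equivalence, the isomorphism of cones is then reflected along the fully faithful
functor `CatWeightedCone.mapFunctor`. For strict limits, cones with identity constraints are
determined by their components (`CatWeightedCone.IsStrict.ext`), so that equalities of cones in
`CAT^2` lift. -/

/-! ### Weighted cones under locally fully faithful pseudofunctors -/

namespace CatWeightedCone

section LocallyFullyFaithful

variable {J : Type u₁} [Bicategory.{w₁, v₁} J]
  {B : Type u₂} [Bicategory.{w₂, v₂} B] {C : Type u₃} [Bicategory.{w₃, v₃} C]
  {W : Pseudofunctor J Cat.{v₄, u₄}} {D : Pseudofunctor J B} {X Y : B}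

@[simp]
theorem id_app (c : CatWeightedCone W D X) (j : J) : Hom.app (𝟙 c) j = 𝟙 (c.app j) := rfl

@[simp]
theorem comp_app {c d e : CatWeightedCone W D X} (m : c ⟶ d) (n : d ⟶ e) (j : J) :
    Hom.app (m ≫ n) j = Hom.app m j ≫ Hom.app n j := rfl

theorem hom_ext {c d : CatWeightedCone W D X} {m n : c ⟶ d}
    (h : ∀ j x, (Hom.app m j).app x = (Hom.app n j).app x) : m = n :=
  Hom.ext (funext fun j => NatTrans.ext (funext (h j)))

/-- An isomorphism of weighted cones from a compatible family of natural isomorphisms. -/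
def isoMk {c d : CatWeightedCone W D X} (e : ∀ j, c.app j ≅ d.app j)
    (comm : ∀ {i j : J} (f : i ⟶ j) (x : W.obj i),
      (e j).hom.app ((W.map f).toFunctor.obj x) ≫ (d.nat f x).hom =
        (c.nat f x).hom ≫ (e i).hom.app x ▷ D.map f) : c ≅ d where
  hom := Hom.mk (fun j => (e j).hom) comm
  inv := Hom.mk (fun j => (e j).inv) fun {i j} f x => by
    rw [← cancel_epi ((e j).hom.app ((W.map f).toFunctor.obj x)), Iso.hom_inv_id_app_assoc,
      ← Category.assoc, comm, Category.assoc, ← comp_whiskerRight, Iso.hom_inv_id_app,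
      id_whiskerRight, Category.comp_id]
  hom_inv_id := hom_ext fun j x => Iso.hom_inv_id_app (e j) x
  inv_hom_id := hom_ext fun j x => Iso.inv_hom_id_app (e j) x

theorem isIso_of_app {c d : CatWeightedCone W D X} (m : c ⟶ d)
    (h : ∀ j x, IsIso ((Hom.app m j).app x)) : IsIso m := by
  have (j : J) : IsIso (Hom.app m j) :=
    have := h j
    NatIso.isIso_of_isIso_app _
  exact inferInstanceAs (IsIso (isoMk (fun j => asIso (Hom.app m j)) (Hom.comm m)).hom)

theorem isIso_app {c d : CatWeightedCone W D X} (m : c ⟶ d) [IsIso m] (j : J) (x : W.obj j) :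
    IsIso ((Hom.app m j).app x) :=
  ⟨(Hom.app (inv m) j).app x,
    congrArg (fun t => (Hom.app t j).app x) (IsIso.hom_inv_id m),
    congrArg (fun t => (Hom.app t j).app x) (IsIso.inv_hom_id m)⟩

/-- The action of a pseudofunctor on weighted cones and their morphisms. It is fully faithful if
the pseudofunctor is fully faithful on hom-categories. -/
def mapFunctor (F : Pseudofunctor B C) (W : Pseudofunctor J Cat.{v₄, u₄}) (D : Pseudofunctor J B)
    (X : B) : CatWeightedCone W D X ⥤ CatWeightedCone W (D.comp F) (F.obj X) where
  obj c := c.map F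
  map {c d} m := Hom.mk (fun j => Functor.whiskerRight (Hom.app m j) (F.mapFunctor X (D.obj j)))
    fun {i j} f x => by
      have := congrArg (fun t => F.map₂ t) (Hom.comm m f x)
      simp only [PrelaxFunctor.map₂_comp] at this
      change F.map₂ ((Hom.app m j).app ((W.map f).toFunctor.obj x)) ≫
          F.map₂ (d.nat f x).hom ≫ (F.mapComp ((d.app i).obj x) (D.map f)).hom =
        (F.map₂ (c.nat f x).hom ≫ (F.mapComp ((c.app i).obj x) (D.map f)).hom) ≫
          F.map₂ ((Hom.app m i).app x) ▷ F.map (D.map f)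
      simp [reassoc_of% this]
  map_id c := hom_ext fun j x => F.map₂_id _
  map_comp m n := hom_ext fun j x => F.map₂_comp _ _

instance (F : Pseudofunctor B C) [∀ a b, (F.mapFunctor a b).Faithful] :
    (mapFunctor F W D X).Faithful where
  map_injective h := hom_ext fun j x => (F.mapFunctor _ _).map_injective
    (congrArg (fun t => (Hom.app t j).app x) h)

instance (F : Pseudofunctor B C) [∀ a b, (F.mapFunctor a b).Faithful]
    [∀ a b, (F.mapFunctor a b).Full] : (mapFunctor F W D X).Full where
  map_surjective {c d} n := by
    let p (j : J) (x : W.obj j) : (c.app j).obj x ⟶ (d.app j).obj x :=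
      (F.mapFunctor X (D.obj j)).preimage ((Hom.app n j).app x)
    have hp (j : J) (x : W.obj j) : F.map₂ (p j x) = (Hom.app n j).app x :=
      (F.mapFunctor X (D.obj j)).map_preimage _
    refine ⟨Hom.mk (fun j => { app := p j, naturality := fun x y u => ?_ }) fun {i j} f x => ?_,
      hom_ext hp⟩
    · apply (F.mapFunctor X (D.obj j)).map_injective
      change F.map₂ _ = F.map₂ _
      rw [F.map₂_comp, F.map₂_comp, hp, hp]
      exact (Hom.app n j).naturality u
    · apply (F.mapFunctor X (D.obj j)).map_injective
      have h : F.map₂ (p j ((W.map f).toFunctor.obj x)) ≫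
          F.map₂ (d.nat f x).hom ≫ (F.mapComp ((d.app i).obj x) (D.map f)).hom =
        (F.map₂ (c.nat f x).hom ≫ (F.mapComp ((c.app i).obj x) (D.map f)).hom) ≫
          F.map₂ (p i x) ▷ F.map (D.map f) := by
        rw [hp, hp]
        exact Hom.comm n f x
      change F.map₂ (p j ((W.map f).toFunctor.obj x) ≫ (d.nat f x).hom) =
        F.map₂ ((c.nat f x).hom ≫ p i x ▷ D.map f)
      rw [← cancel_mono (F.mapComp ((d.app i).obj x) (D.map f)).hom]
      simp [h]

/-- Restriction of weighted cones commutes with the action of a pseudofunctor. -/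
def mapPrecompIso (F : Pseudofunctor B C) (c : CatWeightedCone W D X) (h : Y ⟶ X) :
    (c.precomp h).map F ≅ (c.map F).precomp (F.map h) :=
  isoMk (c := (c.precomp h).map F) (d := (c.map F).precomp (F.map h))
    (fun j => NatIso.ofComponents (fun x => F.mapComp h ((c.app j).obj x)) fun {x y} u => by
      change F.map₂ (h ◁ (c.app j).map u) ≫ _ = _ ≫ F.map h ◁ F.map₂ ((c.app j).map u)
      simp)
    fun {i j} f x => by
      change (F.mapComp h ((c.app j).obj ((W.map f).toFunctor.obj x))).hom ≫
          F.map h ◁ (F.map₂ (c.nat f x).hom ≫ (F.mapComp ((c.app i).obj x) (D.map f)).hom) ≫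
            (α_ (F.map h) (F.map ((c.app i).obj x)) (F.map (D.map f))).inv =
        (F.map₂ (h ◁ (c.nat f x).hom ≫ (α_ h ((c.app i).obj x) (D.map f)).inv) ≫
          (F.mapComp (h ≫ (c.app i).obj x) (D.map f)).hom) ≫
            (F.mapComp h ((c.app i).obj x)).hom ▷ F.map (D.map f)
      have e : F.map₂ (α_ h ((c.app i).obj x) (D.map f)).inv ≫
          (F.mapComp (h ≫ (c.app i).obj x) (D.map f)).hom ≫
            (F.mapComp h ((c.app i).obj x)).hom ▷ F.map (D.map f) =
          (F.mapComp h ((c.app i).obj x ≫ D.map f)).hom ≫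
            F.map h ◁ (F.mapComp ((c.app i).obj x) (D.map f)).hom ≫
              (α_ (F.map h) (F.map ((c.app i).obj x)) (F.map (D.map f))).inv := by
        rw [F.mapComp_assoc_left_hom, ← PrelaxFunctor.map₂_comp_assoc, Iso.inv_hom_id,
          F.map₂_id, Category.id_comp]
      simp [e]

/-- A pseudofunctor carries the comparison functors of a weighted cone to those of its image. -/
def comparisonMapIso (F : Pseudofunctor B C) (c : CatWeightedCone W D X) (Y : B) :
    c.comparison Y ⋙ mapFunctor F W D Y ≅
      F.mapFunctor Y X ⋙ (c.map F).comparison (F.obj Y) :=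
  NatIso.ofComponents (fun h => mapPrecompIso F c h) fun {h k} θ => hom_ext fun j x => by
    change F.map₂ (θ ▷ (c.app j).obj x) ≫ (F.mapComp k ((c.app j).obj x)).hom =
      (F.mapComp h ((c.app j).obj x)).hom ≫ F.map₂ θ ▷ F.map ((c.app j).obj x)
    simp

variable (F : Pseudofunctor B C) [∀ a b, (F.mapFunctor a b).Faithful]
  [∀ a b, (F.mapFunctor a b).Full] (c : CatWeightedCone W D X) (Y : B)

omit [∀ a b, (F.mapFunctor a b).Full] in
theorem comparison_faithful_of_map [((c.map F).comparison (F.obj Y)).Faithful] :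
    (c.comparison Y).Faithful :=
  Functor.Faithful.of_comp_iso (comparisonMapIso F c Y)

theorem comparison_full_of_map [((c.map F).comparison (F.obj Y)).Faithful]
    [((c.map F).comparison (F.obj Y)).Full] : (c.comparison Y).Full :=
  Functor.Full.of_comp_faithful_iso (comparisonMapIso F c Y)

end LocallyFullyFaithful

end CatWeightedCone

/-! ### Weighted limits in the arrow 2-category -/

namespace ArrCAT

variable {X Y : ArrCAT.{w}}

theorem Sq.isIso_of_top_bot {S T : Sq X Y} (η : S ⟶ T) (ht : IsIso (SqHom.top η))
    (hb : IsIso (SqHom.bot η)) : IsIso η :=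
  inferInstanceAs (IsIso (Sq.isoMk (asIso (SqHom.top η)) (asIso (SqHom.bot η))
    (SqHom.comm η)).hom)

theorem Sq.isIso_bot {S T : Sq X Y} (η : S ⟶ T) [IsIso η] : IsIso (SqHom.bot η) :=
  ⟨SqHom.bot (inv η), congrArg SqHom.bot (IsIso.hom_inv_id η),
    congrArg SqHom.bot (IsIso.inv_hom_id η)⟩

theorem Sq.preservesColimits_bot_of_isIso {S T : Sq X Y} (η : S ⟶ T) (hη : IsIso η)
    (hS : PreservesColimitsOfSize.{w, w} S.bot) : PreservesColimitsOfSize.{w, w} T.bot :=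
  have := Sq.isIso_bot η
  preservesColimits_of_natIso (asIso (SqHom.bot η))

attribute [local instance] uliftCategory in
/-- The functor from the empty category to the terminal category. It represents the underlying
category of the codomain: squares from `point` to `X` are the objects of `X.cod`, and `2`-cells
between them are the morphisms of `X.cod`. -/
def point : ArrCAT.{w} where
  dom := ULift.{w + 1} (Discrete PEmpty.{w + 1})
  cod := ULift.{w + 1} (Discrete PUnit.{w + 1})
  fn := ULift.downFunctor ⋙ Functor.empty _

/-- The square from `point` to `X` that selects an object of the codomain of `X`. -/
def ofObj (P : X.cod) : point.{w} ⟶ X where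
  top := { obj := fun x => PEmpty.elim (ULift.down x).as
           map := fun {x} => PEmpty.elim (ULift.down x).as
           map_id := fun x => PEmpty.elim (ULift.down x).as
           map_comp := fun {x} => PEmpty.elim (ULift.down x).as }
  bot := (Functor.const _).obj P
  iso := NatIso.ofComponents (fun x => PEmpty.elim (ULift.down x).as)
    fun {x} => PEmpty.elim (ULift.down x).as

/-- The `2`-cell from `point` to `X` that selects a morphism of the codomain of `X`. -/
def ofHom {P Q : X.cod} (f : P ⟶ Q) : ofObj P ⟶ ofObj Q :=
  SqHom.mk (S := ofObj P) (T := ofObj Q) (𝟙 _) ((Functor.const _).map f)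
    fun x => PEmpty.elim (ULift.down x).as

end ArrCAT

namespace CatWeightedCone

open ArrCAT

variable {J : Type u₁} [Bicategory.{w₁, v₁} J] {W : Pseudofunctor J Cat.{v₄, u₄}}
  {D : Pseudofunctor J ArrCAT.{w}} {X Y : ArrCAT.{w}}

/-- The legs of a weighted limit in `CAT^2` are jointly conservative on codomains: test the
comparison functor, which reflects isomorphisms, on the object `point`. -/
theorem isIso_of_isIso_bot_map (c : CatWeightedCone W D X)
    [(c.comparison point).Full] [(c.comparison point).Faithful] {P Q : X.cod} (f : P ⟶ Q)
    (h : ∀ j x, IsIso ((Sq.bot ((c.app j).obj x)).map f)) : IsIso f := by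
  have : IsIso ((c.comparison point).map (ofHom f)) := by
    refine isIso_of_app _ fun j x => Sq.isIso_of_top_bot _ ?_ ?_
    · exact ⟨{ app := fun x => PEmpty.elim (ULift.down x).as
               naturality := fun x => PEmpty.elim (ULift.down x).as }, by
        ext x; exact PEmpty.elim (ULift.down x).as, by ext x; exact PEmpty.elim (ULift.down x).as⟩
    · exact (NatTrans.isIso_iff_isIso_app _).2 fun _ => h j x
  have : IsIso (ofHom f) := isIso_of_reflects_iso (ofHom f) (c.comparison point)
  exact (NatTrans.isIso_iff_isIso_app _).1 (Sq.isIso_bot (ofHom f))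
    (ULift.up (Discrete.mk PUnit.unit))

/-- A square into a weighted limit in `CAT^2` has a cocontinuous bottom functor as soon as the legs
and their composites with the square do: the legs turn the comparison map of a colimit into an
isomorphism, and they are jointly conservative. -/
theorem preservesColimits_bot (c : CatWeightedCone W D X)
    [(c.comparison point).Full] [(c.comparison point).Faithful]
    [HasColimitsOfSize.{w, w} X.cod] [HasColimitsOfSize.{w, w} Y.cod]
    (hc : ∀ j x, PreservesColimitsOfSize.{w, w} (Sq.bot ((c.app j).obj x)))
    (S : Y ⟶ X)
    (hS : ∀ j x, PreservesColimitsOfSize.{w, w} (Sq.bot S ⋙ Sq.bot ((c.app j).obj x))) :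
    PreservesColimitsOfSize.{w, w} (Sq.bot S) where
  preservesColimitsOfShape {K} _ := ⟨fun {F} => by
    have : IsIso (colimit.post F (Sq.bot S)) := by
      refine c.isIso_of_isIso_bot_map _ fun j x => ?_
      have := hc j x
      have := hS j x
      have e := colimit.post_post F (Sq.bot S) (Sq.bot ((c.app j).obj x))
      exact IsIso.of_isIso_fac_left e
    exact preservesColimit_of_isIso_post (Sq.bot S) F⟩

end CatWeightedCone

/-! ### Limits up to equivalence of categories with arities -/

namespace CatWithArities

variable {X Y : CatWithArities.{w}}

instance : (toArrCAT.mapFunctor X Y).Faithful :=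
  ⟨fun h => (toCwASq_isEquivalence X Y).faithful.map_injective h⟩

instance : (toArrCAT.mapFunctor X Y).Full :=
  ⟨fun η => (toCwASq_isEquivalence X Y).full.map_surjective η⟩

theorem preservesColimits_bot_map (K : X ⟶ Y) :
    PreservesColimitsOfSize.{w, w} (ArrCAT.Sq.bot (toArrCAT.map K)) :=
  (Hom.toSq K).cocont

/-- A square between nerve functors whose functor between presheaf categories is cocontinuous
lies in the essential image of the nerve pseudofunctor. -/
theorem exists_map_iso (S : toArrCAT.obj X ⟶ toArrCAT.obj Y)
    (hS : PreservesColimitsOfSize.{w, w} (ArrCAT.Sq.bot S)) :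
    ∃ K : X ⟶ Y, Nonempty (toArrCAT.map K ≅ S) := by
  let T : CwASq.Hom ⟨X⟩ ⟨Y⟩ := { toSq := S, cocont := hS }
  let K : Hom X Y := ⟨T.top, have := T.cocont; respectsArities_of_iso T.top T.bot T.iso⟩
  exact ⟨K, ⟨(CwASq.toArrCAT.toPseudofunctor.mapFunctor _ _).mapIso
    (CwASq.liftIso (Hom.toSq K) T (Iso.refl (ArrCAT.Sq.top S)))⟩⟩

end CatWithArities

namespace CatWeightedCone

/-- The nerve pseudofunctor reflects bicategorical weighted limits. -/
theorem isLimit_of_isLimit_map_nerve {J : Type u₁} [Bicategory.{w₁, v₁} J]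
    {W : Pseudofunctor J Cat.{v₄, u₄}}
    {D : Pseudofunctor J CatWithArities.{w}} {X : CatWithArities.{w}} (c : CatWeightedCone W D X)
    (hc : (c.map CatWithArities.toArrCAT).IsLimit) : c.IsLimit := by
  intro Y
  have := hc ArrCAT.point
  have := hc (CatWithArities.toArrCAT.obj Y)
  have hfull := c.comparison_full_of_map CatWithArities.toArrCAT Y
  have hfaithful := c.comparison_faithful_of_map CatWithArities.toArrCAT Y
  refine { full := hfull, faithful := hfaithful, essSurj := ⟨fun d => ?_⟩ }
  obtain ⟨S, ⟨e⟩⟩ := Functor.EssSurj.mem_essImage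
    (F := (c.map CatWithArities.toArrCAT).comparison (CatWithArities.toArrCAT.obj Y))
    (d.map CatWithArities.toArrCAT)
  -- The composites of `S` with the legs are isomorphic to the squares of `d`, whose bottom
  -- functors are left Kan extensions.
  have hS : PreservesColimitsOfSize.{w, w} (ArrCAT.Sq.bot S) := by
    have hcolim (Z : CatWithArities.{w}) :
        HasColimitsOfSize.{w, w} (CatWithArities.toArrCAT.obj Z).cod :=
      inferInstanceAs (HasColimitsOfSize.{w, w} Z.Psh)
    have := hcolim X
    have := hcolim Y
    refine preservesColimits_bot (X := CatWithArities.toArrCAT.obj X)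
      (Y := CatWithArities.toArrCAT.obj Y) (c.map CatWithArities.toArrCAT)
      (fun j x => CatWithArities.preservesColimits_bot_map ((c.app j).obj x)) S fun j x => ?_
    exact ArrCAT.Sq.preservesColimits_bot_of_isIso ((Hom.app e.inv j).app x) (isIso_app e.inv j x)
      (CatWithArities.preservesColimits_bot_map ((d.app j).obj x))
  obtain ⟨K, ⟨k⟩⟩ := CatWithArities.exists_map_iso S hS
  exact ⟨K, ⟨(mapFunctor CatWithArities.toArrCAT W D Y).preimageIso
    ((comparisonMapIso CatWithArities.toArrCAT c Y).app K ≪≫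
      ((c.map CatWithArities.toArrCAT).comparison _).mapIso k ≪≫ e)⟩⟩

end CatWeightedCone

/-! ### Strict limits of categories with arities -/

namespace CatWeightedCone

section Strict

variable {J : Type u₁} [Bicategory.{w₁, v₁} J] {B : Type u₂} [Bicategory.{w₂, v₂} B]
  {C : Type u₃} [Bicategory.{w₃, v₃} C]
  {W : Pseudofunctor J Cat.{v₄, u₄}} {D : Pseudofunctor J B} {X Y : B}

theorem IsStrict.precomp [Bicategory.Strict B] {c : CatWeightedCone W D X} (hc : c.IsStrict)
    (h : Y ⟶ X) : (c.precomp h).IsStrict := by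
  intro i j f x
  obtain ⟨e, he⟩ := hc f x
  refine ⟨(congrArg (h ≫ ·) e).trans (Bicategory.Strict.assoc _ _ _).symm, ?_⟩
  change whiskerLeftIso h (c.nat f x) ≪≫ (α_ h ((c.app i).obj x) (D.map f)).symm = _
  rw [he, Bicategory.Strict.associator_eqToIso]
  exact Iso.ext (by simp; rfl)

theorem IsStrict.map {c : CatWeightedCone W D X} (hc : c.IsStrict) (F : StrictPseudofunctor B C) :
    (c.map F.toPseudofunctor).IsStrict := by
  intro i j f x
  obtain ⟨e, he⟩ := hc f x
  refine ⟨(congrArg F.map e).trans (F.map_comp _ _), ?_⟩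
  change F.map₂Iso (c.nat f x) ≪≫ F.mapComp ((c.app i).obj x) (D.map f) = _
  rw [he, F.mapComp_eq_eqToIso]
  exact Iso.ext (by simp [PrelaxFunctor.map₂_eqToHom]; rfl)

/-- A strict weighted cone is determined by its components, since its constraints are
identities. -/
theorem IsStrict.ext {c d : CatWeightedCone W D X} (hc : c.IsStrict) (hd : d.IsStrict)
    (h : ∀ j, c.app j = d.app j) : c = d := by
  obtain ⟨a, n, _, _, _, _⟩ := c
  obtain ⟨b, m, _, _, _, _⟩ := d
  obtain rfl : a = b := funext h
  obtain rfl : @n = @m := by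
    funext i j f x
    obtain ⟨_, e⟩ := hc f x
    obtain ⟨_, e'⟩ := hd f x
    exact e.trans e'.symm
  rfl

end Strict

end CatWeightedCone

/-- Faithful functors that are injective on objects are monomorphisms of categories. -/
theorem functor_eq_of_comp_eq {C D E : Type*} [Category C] [Category D] [Category E]
    {F G : C ⥤ D} (U : D ⥤ E) [U.Faithful] (hU : Function.Injective U.obj)
    (h : F ⋙ U = G ⋙ U) : F = G := by
  refine CategoryTheory.Functor.ext (fun x => hU (Functor.congr_obj h x)) fun x y f =>
    U.map_injective ?_
  simpa [eqToHom_map] using Functor.congr_hom h f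

namespace CwASq

variable {X Y : CwASq.{w}}

instance : (toArrCAT.mapFunctor X Y).Faithful := ⟨fun h => h⟩

instance : (toArrCAT.mapFunctor X Y).Full := ⟨fun η => ⟨η, rfl⟩⟩

end CwASq

namespace CatWeightedCone

/-- The strict nerve `2`-functor reflects `Cat`-enriched weighted limits. -/
theorem isStrictLimit_of_isStrictLimit_map_nerve {J : Type u₁} [Bicategory.{w₁, v₁} J]
    {W : Pseudofunctor J Cat.{v₄, u₄}} {D : Pseudofunctor J CwASq.{w}} {X : CwASq.{w}}
    (c : CatWeightedCone W D X) (hc : c.IsStrict)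
    (hl : (c.map CwASq.toArrCAT.toPseudofunctor).IsStrictLimit) : c.IsStrictLimit := by
  refine ⟨hc, fun Y => ?_⟩
  obtain ⟨hfull, hfaithful, hobj⟩ := hl.2 (CwASq.toArrCAT.obj Y)
  refine ⟨c.comparison_full_of_map CwASq.toArrCAT.toPseudofunctor Y,
    c.comparison_faithful_of_map CwASq.toArrCAT.toPseudofunctor Y, fun d hd => ?_⟩
  obtain ⟨S, hS, hS'⟩ := hobj (d.map CwASq.toArrCAT.toPseudofunctor)
    (IsStrict.map hd CwASq.toArrCAT)
  have happ (j : J) : ((c.map CwASq.toArrCAT.toPseudofunctor).precomp S).app j =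
      (d.map CwASq.toArrCAT.toPseudofunctor).app j :=
    congrArg (fun t => CatWeightedCone.app t j) hS
  have hcocont : PreservesColimitsOfSize.{w, w} (ArrCAT.Sq.bot S) := by
    obtain ⟨_, _, _⟩ := hl.2 ArrCAT.point
    have hcolim (Z : CwASq.{w}) : HasColimitsOfSize.{w, w} (CwASq.toArrCAT.obj Z).cod :=
      inferInstanceAs (HasColimitsOfSize.{w, w} Z.arities.Psh)
    have := hcolim X
    have := hcolim Y
    refine preservesColimits_bot (X := CwASq.toArrCAT.obj X) (Y := CwASq.toArrCAT.obj Y)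
      (c.map CwASq.toArrCAT.toPseudofunctor) (fun j x => ((c.app j).obj x).cocont) S fun j x => ?_
    have h : ArrCAT.Sq.bot S ⋙ ((c.app j).obj x).bot = ((d.app j).obj x).bot :=
      congrArg ArrCAT.Sq.bot (Functor.congr_obj (happ j) x)
    exact h ▸ ((d.app j).obj x).cocont
  let K : Y ⟶ X := { toSq := S, cocont := hcocont : CwASq.Hom Y X }
  refine ⟨K, IsStrict.ext (IsStrict.precomp hc K) hd fun j =>
    functor_eq_of_comp_eq (CwASq.toArrCAT.mapFunctor Y (D.obj j))
      (fun _ _ h => CwASq.Hom.ext' h) (happ j), fun L hL => CwASq.Hom.ext' (hS' L.toSq ?_)⟩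
  -- Uniqueness: restriction along `L` commutes on the nose with passage to `CAT^2`.
  subst hL
  exact IsStrict.ext (IsStrict.precomp (IsStrict.map hc CwASq.toArrCAT) _)
    (IsStrict.map (IsStrict.precomp hc L) CwASq.toArrCAT) fun j => rfl

end CatWeightedCone

theorem mainTheorem1 :
    (∀ {J : Type u₁} [Bicategory.{w₁, v₁} J] (W : Pseudofunctor J Cat.{v₂, u₂})
      (D : Pseudofunctor J CatWithArities.{w}) (X : CatWithArities.{w}) (c : CatWeightedCone W D X),
      (c.map CatWithArities.toArrCAT).IsLimit → c.IsLimit) ∧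
    (∀ {J : Type u₁} [Bicategory.{w₁, v₁} J] [Bicategory.Strict J]
      (W : StrictPseudofunctor J Cat.{v₂, u₂}) (D : StrictPseudofunctor J CwASq.{w})
      (X : CwASq.{w}) (c : CatWeightedCone W.toPseudofunctor D.toPseudofunctor X),
      c.IsStrict → (c.map CwASq.toArrCAT.toPseudofunctor).IsStrictLimit → c.IsStrictLimit) :=
  ⟨fun _ _ _ c hc => c.isLimit_of_isLimit_map_nerve hc,
    fun _ _ _ c hc hl => c.isStrictLimit_of_isStrictLimit_map_nerve hc hl⟩
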